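/- Setting. Let $K,N,B,t$ be integers with $0\le t<K$ and let $\mu=t/K$. A transmitter has $N$ independent, uniformly distributed files of $F$ bits each. A caching strategy $\mathfrak C$ gives every user $k\in[K]$ a finite union $\mathbf c_k\subseteq(0,1]$ of successive intervals $(a,b]$ of total length $\mu$, and user $k$ caches from every file the bits with numbers $\lceil aF\rceil+1,\dots,\lfloor bF\rfloor$ for each of its intervals. Assume that $\mathfrak C$ is centralized: for every $\mathcal T\subseteq[K]$ with $|\mathcal T|=t$, the set of points of $(0,1]$ that lie in $\mathbf c_k$ exactly for $k\in\mathcal T$ has measure $1/\binom Kt$ (the central caching strategy is of this kind). User $k$ requests file $d_k$, where $d_1,\dots,d_K$ are distinct. In each of $n$ channel uses the transmitter sends $X_s\in\mathbb F_2^B$, a function of all the files, and user $k$ receives the first $L_k[s]$ bits of $X_s$. The states $L_k[1],\dots,L_k[n]\in\{0,\dots,B\}$ are i.i.d. with an arbitrary given law $P_{L_k}$, are independent of the files, and are known to user $k$ but not to the transmitter; put $\overline F_{L_k}(\ell)=\mathbb P[L_k\ge\ell]$. User $k$ estimates file $d_k$ from its channel states, its channel outputs and its cache, and $P_e^{(n)}$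 is the sum over $k$ of the probabilities of a wrong estimate. Files of $F_n$ bits are reliably served if there are encoders and decoders for all $n$ with $P_e^{(n)}\to0$. A source rate $f\ge 0$ is achievable if files of some lengths $F_n$ with $F_n/n\to f$ are reliably served. Claim. The linear program that maximizes $f$ over all $f\ge0$ and $y_{\ell,\mathcal S}\ge0$ ($\ell\in[B]$, $\mathcal S\subseteq[K]$, $|\mathcal S|=t+1$) subject to $$\sum_{\mathcal S}y_{\ell,\mathcal S}\le1\quad(\ell\in[B]),\qquad \sum_{\ell=1}^B\overline F_{L_k}(\ell)\,y_{\ell,\mathcal S}\ge\frac f{\binom Kt}\quad(|\mathcal S|=t+1,\ k\in\mathcal S)$$ has an optimal value $f_{\mathsf{LP}}$, and the source rate $f_{\mathsf{LP}}$ is achievable. Moreover, for every $f$ with $0\le f<f_{\mathsf{LP}}$, files of exactly $F_n=\lfloor nf\rfloor$ bits are reliably served. -/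

import Mathlib

open Filter Topology MeasureTheory

namespace CodedCaching

noncomputable section

/-- A caching strategy for `K` users with normalized cache size `μ`: user `k` has the finitely many
intervals `(left k j, right k j] ⊆ (0, 1]`, listed from left to right without overlap
(an interval may be empty), of total length `μ`. -/
structure CachingStrategy (K : ℕ) (μ : ℝ) where
  num : Fin K → ℕ
  num_pos : ∀ k, 0 < num k
  left : (k : Fin K) → Fin (num k) → ℝ
  right : (k : Fin K) → Fin (num k) → ℝ
  left_nonneg : ∀ k j, 0 ≤ left k j
  left_le_right : ∀ k j, left k j ≤ right k j
  right_le_one : ∀ k j, right k j ≤ 1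
  ordered : ∀ k (i j : Fin (num k)), i < j → right k i ≤ left k j
  total_length : ∀ k, ∑ j, (right k j - left k j) = μ

namespace CachingStrategy

variable {K : ℕ} {μ : ℝ}

/-- The part `c_k` of the unit interval that user `k` caches. -/
def region (C : CachingStrategy K μ) (k : Fin K) : Set ℝ :=
  ⋃ j, Set.Ioc (C.left k j) (C.right k j)

/-- The part of the unit interval that is cached by the users in `T` and by nobody else. -/
def exactRegion (C : CachingStrategy K μ) (T : Finset (Fin K)) : Set ℝ :=
  {x | x ∈ Set.Ioc (0 : ℝ) 1 ∧ ∀ k, x ∈ C.region k ↔ k ∈ T}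

/-- Every set of exactly `t` users exclusively shares the same fraction `1 / (K choose t)`
of each file. -/
def IsCentralized (C : CachingStrategy K μ) (t : ℕ) : Prop :=
  ∀ T : Finset (Fin K), T.card = t → volume.real (C.exactRegion T) = 1 / (K.choose t : ℝ)

/-- The positions of the bits of a file of `F` bits that user `k` caches: the bits with numbers
`⌈a F⌉ + 1, …, ⌊b F⌋` for the intervals `(a, b]` of the user. The element `i : Fin F` stands for
the bit with number `i + 1`. -/
def cachedBits (C : CachingStrategy K μ) (F : ℕ) (k : Fin K) : Set (Fin F) :=
  {i | ∃ j, ⌈C.left k j * F⌉ + 1 ≤ (i : ℤ) + 1 ∧ (i : ℤ) + 1 ≤ ⌊C.right k j * F⌋}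

end CachingStrategy

/-- A library of `N` files of `F` bits each. -/
abbrev Library (N F : ℕ) : Type := Fin N → Fin F → ZMod 2

/-- The complementary distribution function of the channel state of one user at the level
with number `ℓ + 1`: the probability that at least `ℓ + 1` bits are delivered. -/
def ccdf {B : ℕ} (p : PMF (Fin (B + 1))) (ℓ : Fin B) : ℝ :=
  p.toMeasure.real {m | (ℓ : ℕ) + 1 ≤ (m : ℕ)}

/-- The output of the channel: of the `B` bits sent, the first `L` ones are delivered, and the
others are blanked out. -/
def received {B : ℕ} (L : Fin (B + 1)) (x : Fin B → ZMod 2) : Fin B → ZMod 2 :=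
  fun ℓ => if (ℓ : ℕ) + 1 ≤ (L : ℕ) then x ℓ else 0

/-- The cache of user `k`: its bits of all the files. -/
def cacheContent {K : ℕ} {μ : ℝ} (C : CachingStrategy K μ) {N F : ℕ} (k : Fin K)
    (W : Library N F) : Fin N → C.cachedBits F k → ZMod 2 :=
  fun i j => W i j

/-- An encoder and `K` decoders for block length `n` and files of `F` bits. The encoder sees the
library (which determines all the caches), but not the channel states. The decoder of user `k` sees
the channel states of that user, the channel outputs and the cache of that user. -/
structure Code {K : ℕ} {μ : ℝ} (C : CachingStrategy K μ) (N B n F : ℕ) where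
  encode : Library N F → Fin n → Fin B → ZMod 2
  decode : (k : Fin K) → (Fin n → Fin (B + 1)) → (Fin n → Fin B → ZMod 2) →
    (Fin N → C.cachedBits F k → ZMod 2) → Fin F → ZMod 2

/-- The estimate of user `k` when the library is `W` and its channel states are `L`. -/
def Code.estimate {K : ℕ} {μ : ℝ} {C : CachingStrategy K μ} {N B n F : ℕ} (c : Code C N B n F)
    (k : Fin K) (W : Library N F) (L : Fin n → Fin (B + 1)) : Fin F → ZMod 2 :=
  c.decode k L (fun s => received (L s) (c.encode W s)) (cacheContent C k W)

/-- The sum over the users of the probabilities of decoding the requested file wrongly. The library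
is uniformly distributed and independent of the channel states; the states of user `k` are
independent over time with law `P k`. How the states of different users depend on each other does
not affect this sum. -/
def Code.errorProb {K : ℕ} {μ : ℝ} {C : CachingStrategy K μ} {N B n F : ℕ} (c : Code C N B n F)
    (P : Fin K → PMF (Fin (B + 1))) (d : Fin K → Fin N) : ℝ :=
  ∑ k, (∑ W : Library N F,
    (Measure.pi fun _ : Fin n => (P k).toMeasure).real {L | c.estimate k W L ≠ W (d k)}) /
      Fintype.card (Library N F)

/-- With files of `F n` bits at block length `n`, the requests `d` can be served with an error
probability that tends to `0`. -/
def ReliablyServed {K : ℕ} {μ : ℝ} (C : CachingStrategy K μ) {N B : ℕ}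
    (P : Fin K → PMF (Fin (B + 1))) (d : Fin K → Fin N) (F : ℕ → ℕ) : Prop :=
  ∃ c : (n : ℕ) → Code C N B n (F n), Tendsto (fun n => (c n).errorProb P d) atTop (𝓝 0)

/-- The source rate `f` (in bits per file and channel use) is achievable: files of `n f + o(n)` bits
can be served with an error probability that tends to `0`. -/
def IsAchievable {K : ℕ} {μ : ℝ} (C : CachingStrategy K μ) {N B : ℕ}
    (P : Fin K → PMF (Fin (B + 1))) (d : Fin K → Fin N) (f : ℝ) : Prop :=
  ∃ F : ℕ → ℕ, Tendsto (fun n => (F n : ℝ) / n) atTop (𝓝 f) ∧ ReliablyServed C P d F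

/-- Feasibility of the rate `f` and the allocation `y` of time fractions of the levels to the
coded messages, which are indexed by the sets of `t + 1` users. -/
structure LPFeasible {K B : ℕ} (P : Fin K → PMF (Fin (B + 1))) (t : ℕ) (f : ℝ)
    (y : Fin B → {S : Finset (Fin K) // S.card = t + 1} → ℝ) : Prop where
  rate_nonneg : 0 ≤ f
  nonneg : ∀ ℓ S, 0 ≤ y ℓ S
  level : ∀ ℓ, ∑ S, y ℓ S ≤ 1
  decodable : ∀ S, ∀ k ∈ S.1, f / (K.choose t : ℝ) ≤ ∑ ℓ, ccdf (P k) ℓ * y ℓ S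

/-- The rates that are feasible for the linear program. -/
def lpRates {K B : ℕ} (P : Fin K → PMF (Fin (B + 1))) (t : ℕ) : Set ℝ :=
  {f | ∃ y, LPFeasible P t f y}

/-- The optimal value of the linear program. -/
def fLP {K B : ℕ} (P : Fin K → PMF (Fin (B + 1))) (t : ℕ) : ℝ :=
  sSup (lpRates P t)

end

end CodedCaching

/-!
As in coded caching, each set `S` of `t + 1` users gets the sum of the subfiles that a user in `S`
requests and the others in `S` cache, and each user in `S` recovers its own subfile from this sum.
Rounding at the end points of the cache intervals affects only a bounded number of bits, which are
added to every message.

An allocation `y` of the linear program tells for how many channel uses bit `ℓ` carries the message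
of `S`. The bits of a message are read off a uniformly random codebook, so that a user who receives
more bits than the message has is unlikely to confuse it with another one. By Chebyshev's
inequality the number of received bits deviates from its mean by the order of `√n`. A backoff of
larger order therefore suffices, and it costs nothing in rate. Since the feasible set is compact,
the optimum is attained, and the rate `f_LP` itself can be served in this way.
-/

namespace CodedCaching

noncomputable section

open scoped Finset Function

section Cell

variable {F : ℕ} {i : Fin F} {x e : ℝ}

/-- The open subinterval of `(0, 1]` that belongs to bit `i` of a file of `F` bits. Open cells do
not notice whether a cache interval ends exactly between two bits. -/
def cell (i : Fin F) : Set ℝ := Set.Ioo ((i : ℝ) / F) (((i : ℝ) + 1) / F)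

lemma measurableSet_cell (i : Fin F) : MeasurableSet (cell i) := measurableSet_Ioo

lemma mem_cell : x ∈ cell i ↔ (i : ℝ) < x * F ∧ x * F < i + 1 := by
  have hF : (0 : ℝ) < F := by exact_mod_cast i.pos
  rw [cell, Set.mem_Ioo, div_lt_iff₀ hF, lt_div_iff₀ hF]

lemma measureReal_cell (i : Fin F) : volume.real (cell i) = 1 / F := by
  rw [cell, Real.volume_real_Ioo_of_le (by gcongr; linarith)]
  ring

lemma cell_subset_Ioc (i : Fin F) : cell i ⊆ Set.Ioc 0 1 := by
  have hiF : (i : ℝ) + 1 ≤ F := by exact_mod_cast i.isLt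
  exact Set.Ioo_subset_Ioc_self.trans
    (Set.Ioc_subset_Ioc (by positivity) (div_le_one_of_le₀ hiF (Nat.cast_nonneg F)))

lemma eq_of_mem_cell {i' : Fin F} (h : x ∈ cell i) (h' : x ∈ cell i') : i = i' := by
  rw [mem_cell] at h h'
  have h₁ : (i : ℕ) < i' + 1 := by exact_mod_cast h.1.trans h'.2
  have h₂ : (i' : ℕ) < i + 1 := by exact_mod_cast h'.1.trans h.2
  exact Fin.ext (by lia)

lemma pairwise_disjoint_cell : Pairwise (Disjoint on (cell : Fin F → Set ℝ)) :=
  fun _ _ hne => Set.disjoint_left.2 fun _ h h' => hne (eq_of_mem_cell h h')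

lemma lt_iff_mul_le_of_notMem_cell (hx : x ∈ cell i) (he : e ∉ cell i) :
    e < x ↔ e * F ≤ i := by
  have hF : (0 : ℝ) < F := by exact_mod_cast i.pos
  rw [mem_cell] at hx he
  rw [← mul_lt_mul_iff_of_pos_right hF]
  refine ⟨fun h => ?_, fun h => h.trans_lt hx.1⟩
  by_contra! hlt
  exact he ⟨hlt, h.trans hx.2⟩

lemma le_iff_le_mul_of_notMem_cell (hx : x ∈ cell i) (he : e ∉ cell i) :
    x ≤ e ↔ (i : ℝ) + 1 ≤ e * F := by
  have hF : (0 : ℝ) < F := by exact_mod_cast i.pos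
  rw [mem_cell] at hx he
  rw [← mul_le_mul_iff_of_pos_right hF]
  refine ⟨fun h => ?_, fun h => hx.2.le.trans h⟩
  by_contra! hlt
  exact he ⟨hx.1.trans_le h, hlt⟩

lemma card_le_mul_measureReal_of_cell_subset {A : Finset (Fin F)} {X : Set ℝ}
    (hX : volume X ≠ ⊤) (h : ∀ i ∈ A, cell i ⊆ X) : (#A : ℝ) ≤ F * volume.real X := by
  rcases Nat.eq_zero_or_pos F with rfl | hF
  · simp [A.eq_empty_of_isEmpty]
  have hunion : volume.real (⋃ i ∈ A, cell i) = #A / F := by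
    rw [measureReal_biUnion_finset (pairwise_disjoint_cell.set_pairwise _)
      (fun i _ => measurableSet_cell i)
      (fun i hi => measure_ne_top_of_subset (h i hi) hX)]
    simp [measureReal_cell, div_eq_mul_inv]
  rw [← div_le_iff₀' (by exact_mod_cast hF), ← hunion]
  exact measureReal_mono (Set.iUnion₂_subset h) hX

end Cell

namespace CachingStrategy

variable {K F t : ℕ} {μ : ℝ} (C : CachingStrategy K μ)

lemma measurableSet_region (k : Fin K) : MeasurableSet (C.region k) :=
  MeasurableSet.iUnion fun _ => measurableSet_Ioc

lemma measurableSet_exactRegion (T : Finset (Fin K)) : MeasurableSet (C.exactRegion T) :=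
  measurableSet_setOfPred.2 <| measurableSet_Ioc.mem.and <|
    Measurable.forall fun k => (C.measurableSet_region k).mem.iff measurable_const

lemma exactRegion_subset_Ioc (T : Finset (Fin K)) : C.exactRegion T ⊆ Set.Ioc 0 1 :=
  fun _ hx => hx.1

lemma volume_exactRegion_ne_top (T : Finset (Fin K)) : volume (C.exactRegion T) ≠ ⊤ :=
  measure_ne_top_of_subset (C.exactRegion_subset_Ioc T) measure_Ioc_lt_top.ne

lemma pairwise_disjoint_exactRegion : Pairwise (Disjoint on C.exactRegion) :=
  fun _ _ hne => Set.disjoint_left.2 fun _ hx hx' =>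
    hne (Finset.ext fun k => (hx.2 k).symm.trans (hx'.2 k))

lemma sum_measureReal_exactRegion_le_one (𝒯 : Finset (Finset (Fin K))) :
    ∑ T ∈ 𝒯, volume.real (C.exactRegion T) ≤ 1 := by
  rw [← measureReal_biUnion_finset (C.pairwise_disjoint_exactRegion.set_pairwise _)
    (fun T _ => C.measurableSet_exactRegion T) (fun T _ => C.volume_exactRegion_ne_top T)]
  calc volume.real (⋃ T ∈ 𝒯, C.exactRegion T)
      ≤ volume.real (Set.Ioc (0 : ℝ) 1) :=
        measureReal_mono (Set.iUnion₂_subset fun T _ => C.exactRegion_subset_Ioc T)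
          measure_Ioc_lt_top.ne
    _ = 1 := by simp

variable {C} in
lemma IsCentralized.measureReal_exactRegion_eq_zero (hC : C.IsCentralized t) (htK : t < K)
    {T : Finset (Fin K)} (hT : #T ≠ t) : volume.real (C.exactRegion T) = 0 := by
  have hfull : ∑ T' ∈ Finset.univ.powersetCard t, volume.real (C.exactRegion T') = 1 := by
    have hne : (K.choose t : ℝ) ≠ 0 := by exact_mod_cast (Nat.choose_pos htK.le).ne'
    rw [Finset.sum_congr rfl fun T' hT' => hC T' (Finset.mem_powersetCard.1 hT').2]
    simp [hne]
  have hle := C.sum_measureReal_exactRegion_le_one (insert T (Finset.univ.powersetCard t))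
  rw [Finset.sum_insert (by simp [hT]), hfull] at hle
  linarith [measureReal_nonneg (μ := volume) (s := C.exactRegion T)]

open Classical in
/-- The users that cache the bit at position `i`, that is, the user set of the subfile that contains
this bit. -/
def cachers (i : Fin F) : Finset (Fin K) := {k | i ∈ C.cachedBits F k}

variable {C} in
lemma mem_cachers {i : Fin F} {k : Fin K} : k ∈ C.cachers i ↔ i ∈ C.cachedBits F k := by
  simp [cachers]

/-- The end points of all the cache intervals. -/
def endpoints : Finset ℝ :=
  Finset.univ.image (fun q : Σ k, Fin (C.num k) => C.left q.1 q.2) ∪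
    Finset.univ.image (fun q : Σ k, Fin (C.num k) => C.right q.1 q.2)

lemma left_mem_endpoints (k : Fin K) (j : Fin (C.num k)) : C.left k j ∈ C.endpoints :=
  Finset.mem_union_left _ (Finset.mem_image_of_mem (fun q : Σ k, Fin (C.num k) => C.left q.1 q.2)
    (Finset.mem_univ ⟨k, j⟩))

lemma right_mem_endpoints (k : Fin K) (j : Fin (C.num k)) : C.right k j ∈ C.endpoints :=
  Finset.mem_union_right _ (Finset.mem_image_of_mem (fun q : Σ k, Fin (C.num k) => C.right q.1 q.2)
    (Finset.mem_univ ⟨k, j⟩))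

open Classical in
/-- The bits whose cell is cut by an end point. Rounding can separate the bits that a user caches
from the region that the user caches only at these bits. -/
def boundaryBits (F : ℕ) : Finset (Fin F) := {i | ∃ e ∈ C.endpoints, e ∈ cell i}

lemma card_boundaryBits_le (F : ℕ) : #(C.boundaryBits F) ≤ #C.endpoints := by
  have hcut : ∀ i ∈ C.boundaryBits F, ∃ e ∈ C.endpoints, e ∈ cell i := by simp [boundaryBits]
  choose! e he hcell using hcut
  exact Finset.card_le_card_of_injOn e he fun i hi i' hi' heq =>
    eq_of_mem_cell (hcell i hi) (heq ▸ hcell i' hi')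

variable {C} in
lemma mem_region_iff_mem_cachedBits {i : Fin F} (hi : i ∉ C.boundaryBits F) {x : ℝ}
    (hx : x ∈ cell i) (k : Fin K) : x ∈ C.region k ↔ i ∈ C.cachedBits F k := by
  have huncut : ∀ e ∈ C.endpoints, e ∉ cell i := by simpa [boundaryBits] using hi
  simp only [region, cachedBits, Set.mem_iUnion, Set.mem_Ioc, Set.mem_ofPred_eq,
    add_le_add_iff_right, Int.ceil_le, Int.le_floor]
  push_cast
  exact exists_congr fun j => and_congr
    (lt_iff_mul_le_of_notMem_cell hx (huncut _ (C.left_mem_endpoints k j)))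
    (le_iff_le_mul_of_notMem_cell hx (huncut _ (C.right_mem_endpoints k j)))

variable {C} in
lemma cell_subset_exactRegion {i : Fin F} (hi : i ∉ C.boundaryBits F) :
    cell i ⊆ C.exactRegion (C.cachers i) := fun _ hx =>
  ⟨cell_subset_Ioc i hx, fun k => (mem_region_iff_mem_cachedBits hi hx k).trans mem_cachers.symm⟩

namespace IsCentralized

variable {C}

lemma card_cachers_eq (hC : C.IsCentralized t) (htK : t < K) {i : Fin F}
    (hi : i ∉ C.boundaryBits F) : #(C.cachers i) = t := by
  by_contra hne
  have hle := card_le_mul_measureReal_of_cell_subset (A := {i})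
    (C.volume_exactRegion_ne_top _) (by simpa using cell_subset_exactRegion hi)
  rw [hC.measureReal_exactRegion_eq_zero htK hne] at hle
  norm_num at hle

lemma card_filter_card_cachers_ne_le (hC : C.IsCentralized t) (htK : t < K) (F : ℕ) :
    #{i : Fin F | #(C.cachers i) ≠ t} ≤ #C.endpoints :=
  (Finset.card_le_card fun i hi => by
    by_contra hb
    exact (Finset.mem_filter.1 hi).2 (hC.card_cachers_eq htK hb)).trans (C.card_boundaryBits_le F)

lemma card_filter_cachers_eq_le (hC : C.IsCentralized t) (F : ℕ) {T : Finset (Fin K)}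
    (hT : #T = t) : (#{i : Fin F | C.cachers i = T} : ℝ) ≤ F / K.choose t + #C.endpoints := by
  have hsplit : ({i | C.cachers i = T} : Finset (Fin F)) ⊆
      ({i | C.cachers i = T ∧ i ∉ C.boundaryBits F} : Finset (Fin F)) ∪ C.boundaryBits F := by
    intro i
    simp only [Finset.mem_union, Finset.mem_filter_univ]
    tauto
  have hinner : (#{i : Fin F | C.cachers i = T ∧ i ∉ C.boundaryBits F} : ℝ) ≤ F / K.choose t := by
    rw [← mul_one_div, ← hC T hT]
    refine card_le_mul_measureReal_of_cell_subset (C.volume_exactRegion_ne_top T) fun i hi => ?_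
    obtain ⟨rfl, hb⟩ := (Finset.mem_filter_univ i).1 hi
    exact cell_subset_exactRegion hb
  calc (#{i : Fin F | C.cachers i = T} : ℝ)
      ≤ #{i : Fin F | C.cachers i = T ∧ i ∉ C.boundaryBits F} + #(C.boundaryBits F) := by
        exact_mod_cast (Finset.card_le_card hsplit).trans (Finset.card_union_le _ _)
    _ ≤ F / K.choose t + #C.endpoints :=
        add_le_add hinner (by exact_mod_cast C.card_boundaryBits_le F)

end IsCentralized

end CachingStrategy

section CodedMessages

variable {K N t F g : ℕ} {μ : ℝ}

/-- The sets of `t + 1` users, which index the coded messages. -/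
abbrev UserSet (K t : ℕ) : Type := {S : Finset (Fin K) // #S = t + 1}

lemma exists_userSet_mem (htK : t < K) (k : Fin K) : ∃ S : UserSet K t, k ∈ S.1 := by
  obtain ⟨S, hkS, hS⟩ := Finset.exists_superset_card_eq (s := {k}) (n := t + 1) (by simp)
    (by simpa using htK)
  exact ⟨⟨S, hS⟩, Finset.singleton_subset_iff.1 hkS⟩

namespace CachingStrategy

variable (C : CachingStrategy K μ)

/-- The index, starting at `0`, of the bit at position `i` in its subfile: the number of earlier
bits that are cached by the same users. -/
def subfileIndex (i : Fin F) : ℕ := #{i' | C.cachers i' = C.cachers i ∧ i' < i}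

variable {C}

lemma subfileIndex_lt_card (i : Fin F) :
    C.subfileIndex i < #{i' : Fin F | C.cachers i' = C.cachers i} :=
  Finset.card_lt_card <| Finset.ssubset_iff_of_subset
    (Finset.monotone_filter_right _ fun _ _ h => h.1) |>.2 ⟨i, by simp⟩

lemma subfileIndex_lt_subfileIndex {i i' : Fin F} (heq : C.cachers i = C.cachers i')
    (hlt : i < i') : C.subfileIndex i < C.subfileIndex i' :=
  Finset.card_lt_card <| Finset.ssubset_iff_of_subset
    (Finset.monotone_filter_right _ fun _ _ h => ⟨h.1.trans heq, h.2.trans hlt⟩) |>.2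
      ⟨i, by simp [heq, hlt]⟩

lemma eq_of_subfileIndex_eq {i i' : Fin F} (heq : C.cachers i = C.cachers i')
    (hidx : C.subfileIndex i = C.subfileIndex i') : i = i' := by
  rcases lt_trichotomy i i' with hlt | rfl | hlt
  · exact absurd hidx (subfileIndex_lt_subfileIndex heq hlt).ne
  · rfl
  · exact absurd hidx (subfileIndex_lt_subfileIndex heq.symm hlt).ne'

variable (C) (d : Fin K → Fin N)

/-- The sum over the users `j ∈ S` of the subfile that `j` requests and the users in `S \ {j}`
cache. Subfiles are padded with zeros to the common length `g`. -/
def xorMessage (g : ℕ) (S : Finset (Fin K)) (W : Library N F) : Fin g → ZMod 2 :=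
  fun p => ∑ j ∈ S, ∑ i with C.cachers i = S.erase j ∧ C.subfileIndex i = p, W (d j) i

variable {C d} in
lemma apply_eq_of_xorMessage_eq {k : Fin K} {i : Fin F} (hk : k ∉ C.cachers i)
    (hg : C.subfileIndex i < g) {W W' : Library N F}
    (hcache : cacheContent C k W = cacheContent C k W')
    (hxor : C.xorMessage d g (insert k (C.cachers i)) W =
      C.xorMessage d g (insert k (C.cachers i)) W') :
    W (d k) i = W' (d k) i := by
  have hwanted (V : Library N F) : ∑ i' with C.cachers i' = C.cachers i ∧
      C.subfileIndex i' = C.subfileIndex i, V (d k) i' = V (d k) i := by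
    rw [Finset.sum_eq_single_of_mem i (by simp)]
    intro i' hi' hne
    obtain ⟨heq, hidx⟩ := (Finset.mem_filter_univ i').1 hi'
    exact absurd (eq_of_subfileIndex_eq heq hidx) hne
  have hknown : ∀ j ∈ C.cachers i,
      ∑ i' with C.cachers i' = (insert k (C.cachers i)).erase j ∧
        C.subfileIndex i' = C.subfileIndex i, W (d j) i' =
      ∑ i' with C.cachers i' = (insert k (C.cachers i)).erase j ∧
        C.subfileIndex i' = C.subfileIndex i, W' (d j) i' := by
    refine fun j hj => Finset.sum_congr rfl fun i' hi' => ?_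
    have hki' : k ∈ C.cachers i' := by
      rw [((Finset.mem_filter_univ i').1 hi').1]
      exact Finset.mem_erase.2 ⟨(ne_of_mem_of_not_mem hj hk).symm, Finset.mem_insert_self _ _⟩
    exact congrFun (congrFun hcache (d j)) ⟨i', mem_cachers.1 hki'⟩
  have h := congrFun hxor ⟨C.subfileIndex i, hg⟩
  simp only [xorMessage, Finset.sum_insert hk, Finset.erase_insert hk] at h
  rwa [hwanted, hwanted, Finset.sum_congr rfl hknown, add_left_inj] at h

/-- The values of the coded messages: a sum of subfiles of length `g`, and the bits of all the
requested files that are not cached by exactly `t` users. -/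
abbrev MessageSpace (t F g : ℕ) : Type :=
  (Fin g → ZMod 2) × (Fin K × {i : Fin F // #(C.cachers i) ≠ t} → ZMod 2)

/-- The coded message for the users in `S`. Each message repeats the exceptional bits, which are so
few that they cost no rate. -/
def codedMessage (t g : ℕ) (S : Finset (Fin K)) (W : Library N F) : C.MessageSpace t F g :=
  (C.xorMessage d g S W, fun q => W (d q.1) q.2)

variable {C d}

lemma apply_eq_of_codedMessage_eq (htK : t < K)
    (hg : ∀ T : Finset (Fin K), #T = t → #{i : Fin F | C.cachers i = T} ≤ g) {k : Fin K}
    {W W' : Library N F} (hcache : cacheContent C k W = cacheContent C k W')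
    (hmsg : ∀ S : UserSet K t, k ∈ S.1 → C.codedMessage d t g S W = C.codedMessage d t g S W') :
    W (d k) = W' (d k) := by
  ext i
  by_cases hk : k ∈ C.cachers i
  · exact congrFun (congrFun hcache (d k)) ⟨i, mem_cachers.1 hk⟩
  by_cases hi : #(C.cachers i) = t
  · have hcard : #(insert k (C.cachers i)) = t + 1 := by rw [Finset.card_insert_of_notMem hk, hi]
    exact apply_eq_of_xorMessage_eq hk ((subfileIndex_lt_card i).trans_le (hg _ hi)) hcache
      (congrArg Prod.fst (hmsg ⟨_, hcard⟩ (Finset.mem_insert_self _ _)))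
  · obtain ⟨S, hkS⟩ := exists_userSet_mem htK k
    exact congrFun (congrArg Prod.snd (hmsg S hkS)) (k, ⟨i, hi⟩)

lemma IsCentralized.card_messageSpace_le (hC : C.IsCentralized t) (htK : t < K) (F g : ℕ) :
    Fintype.card (C.MessageSpace t F g) ≤ 2 ^ (g + K * #C.endpoints) := by
  have hexc : Fintype.card {i : Fin F // #(C.cachers i) ≠ t} ≤ #C.endpoints := by
    rw [Fintype.card_subtype]
    exact hC.card_filter_card_cachers_ne_le htK F
  simp only [MessageSpace, Fintype.card_prod, Fintype.card_fun, ZMod.card, Fintype.card_fin,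
    ← pow_add]
  gcongr
  norm_num

end CachingStrategy

end CodedMessages

section RandomCodebooks

/-- The codeword of `v` in the codebook `E` agrees on the positions `R` with another codeword, so
that `v` cannot be recovered from these positions. -/
def Confusable {A ι β : Type*} (E : A → ι → β) (v : A) (R : Finset ι) : Prop :=
  ∃ w ≠ v, ∀ i ∈ R, E w i = E v i

lemma natCard_eqOn_codewords_mul {A ι G : Type*} [AddCommGroup G] {v w : A} (hwv : w ≠ v)
    (R : Finset ι) :
    Nat.card {E : A → ι → G // ∀ i ∈ R, E w i = E v i} * Nat.card G ^ #R =
      Nat.card (A → ι → G) := by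
  classical
  let diff : (A → ι → G) →+ (R → G) :=
    { toFun := fun E i => E w i - E v i
      map_zero' := by ext; simp
      map_add' := fun E E' => by ext; simp only [Pi.add_apply]; abel }
  have hsurj : Function.Surjective diff := fun u =>
    ⟨Pi.single w fun i => if hi : i ∈ R then u ⟨i, hi⟩ else 0, by ext i; simp [diff, hwv.symm]⟩
  have hker : Nat.card {E : A → ι → G // ∀ i ∈ R, E w i = E v i} = Nat.card diff.ker :=
    Nat.card_congr <| Equiv.subtypeEquivRight fun E => by
      simp [diff, AddMonoidHom.mem_ker, funext_iff, sub_eq_zero]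
  have hindex : diff.ker.index = Nat.card G ^ #R := by
    rw [AddSubgroup.index_ker, AddMonoidHom.range_eq_top.2 hsurj, AddSubgroup.card_top,
      Nat.card_fun, Nat.card_eq_fintype_card (α := R), Fintype.card_coe]
  rw [hker, ← hindex, AddSubgroup.card_mul_index]

lemma natCard_confusable_mul_le {A ι G : Type*} [Fintype A] [Finite ι] [AddCommGroup G] [Finite G]
    (v : A) (R : Finset ι) :
    Nat.card {E : A → ι → G // Confusable E v R} * Nat.card G ^ #R ≤
      Fintype.card A * Nat.card (A → ι → G) := by
  classical
  have := Fintype.ofFinite (A → ι → G)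
  have hunion : #{E : A → ι → G | Confusable E v R} ≤
      ∑ w with w ≠ v, #{E : A → ι → G | ∀ i ∈ R, E w i = E v i} :=
    (Finset.card_le_card fun E hE => by
      obtain ⟨w, hw, hagree⟩ := (Finset.mem_filter_univ E).1 hE
      exact Finset.mem_biUnion.2 ⟨w, by simpa using hw, by simpa using hagree⟩).trans
        Finset.card_biUnion_le
  calc Nat.card {E : A → ι → G // Confusable E v R} * Nat.card G ^ #R
      ≤ (∑ w with w ≠ v, Nat.card {E : A → ι → G // ∀ i ∈ R, E w i = E v i}) *
          Nat.card G ^ #R := by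
        gcongr
        simpa only [Nat.card_eq_fintype_card, Fintype.card_subtype] using hunion
    _ = ∑ w : A with w ≠ v, Nat.card (A → ι → G) := by
        rw [Finset.sum_mul]
        exact Finset.sum_congr rfl fun w hw =>
          natCard_eqOn_codewords_mul (Finset.mem_filter.1 hw).2 R
    _ ≤ Fintype.card A * Nat.card (A → ι → G) := by
        rw [Finset.sum_const, smul_eq_mul]
        exact Nat.mul_le_mul_right _ (Finset.card_le_univ _)

lemma natCard_confusable_le {A ι : Type*} [Fintype A] [Finite ι] {m h : ℕ}
    (hA : Fintype.card A ≤ 2 ^ m) (v : A) {R : Finset ι} (hR : m + h ≤ #R) :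
    (Nat.card {E : A → ι → ZMod 2 // Confusable E v R} : ℝ) ≤
      (1 / 2) ^ h * Nat.card (A → ι → ZMod 2) := by
  have hcount : Nat.card {E : A → ι → ZMod 2 // Confusable E v R} * 2 ^ h * 2 ^ m ≤
      Nat.card (A → ι → ZMod 2) * 2 ^ m :=
    calc Nat.card {E : A → ι → ZMod 2 // Confusable E v R} * 2 ^ h * 2 ^ m
        = Nat.card {E : A → ι → ZMod 2 // Confusable E v R} * 2 ^ (m + h) := by ring
      _ ≤ Nat.card {E : A → ι → ZMod 2 // Confusable E v R} * Nat.card (ZMod 2) ^ #R := by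
          rw [Nat.card_zmod]
          gcongr
          norm_num
      _ ≤ Fintype.card A * Nat.card (A → ι → ZMod 2) := natCard_confusable_mul_le v R
      _ ≤ Nat.card (A → ι → ZMod 2) * 2 ^ m := by
          rw [mul_comm]
          gcongr
  rw [one_div_pow, one_div_mul_eq_div, le_div_iff₀ (by positivity)]
  exact_mod_cast Nat.le_of_mul_le_mul_right hcount (by positivity)

/-- By Fubini, the average over the indices can be taken for each outcome separately. -/
lemma sum_measureReal_le_card_mul {Ω 𝓔 : Type*} [Fintype 𝓔] [MeasurableSpace Ω] {ν : Measure Ω}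
    [IsProbabilityMeasure ν] {bad : 𝓔 → Set Ω} (hbad : ∀ E, MeasurableSet (bad E)) {U : Set Ω}
    (hU : MeasurableSet U) {ε : ℝ} (hε : 0 ≤ ε)
    (h : ∀ x ∉ U, (Nat.card {E // x ∈ bad E} : ℝ) ≤ ε * Nat.card 𝓔) :
    ∑ E, ν.real (bad E) ≤ Nat.card 𝓔 * (ν.real U + ε) := by
  classical
  have hint {s : Set Ω} (hs : MeasurableSet s) : Integrable (s.indicator (1 : Ω → ℝ)) ν :=
    (integrable_const 1).indicator hs
  have hpoint (x : Ω) : ∑ E, (bad E).indicator (1 : Ω → ℝ) x ≤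
      Nat.card 𝓔 * (U.indicator (1 : Ω → ℝ) x + ε) := by
    have hsum : ∑ E, (bad E).indicator (1 : Ω → ℝ) x = Nat.card {E // x ∈ bad E} := by
      simp [Set.indicator_apply, Fintype.card_subtype]
    rw [hsum, mul_comm]
    by_cases hx : x ∈ U
    · have hle : (Nat.card {E // x ∈ bad E} : ℝ) ≤ Nat.card 𝓔 := by
        exact_mod_cast Finite.card_subtype_le _
      simpa [hx] using hle.trans (le_mul_of_one_le_left (by positivity) (by linarith))
    · simpa [hx] using h x hx
  calc ∑ E, ν.real (bad E) = ∫ x, ∑ E, (bad E).indicator (1 : Ω → ℝ) x ∂ν := by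
        rw [integral_finsetSum _ fun E _ => hint (hbad E)]
        simp only [integral_indicator_one (hbad _)]
    _ ≤ ∫ x, Nat.card 𝓔 * (U.indicator (1 : Ω → ℝ) x + ε) ∂ν :=
        integral_mono (integrable_finsetSum _ fun E _ => hint (hbad E))
          (((hint hU).add (integrable_const ε)).const_mul _) hpoint
    _ = Nat.card 𝓔 * (ν.real U + ε) := by
        rw [integral_const_mul, integral_add (hint hU) (integrable_const ε),
          integral_indicator_one hU]
        simp

end RandomCodebooks

section RandomCoding

variable {K N B n F m h : ℕ} {μ : ℝ} {C : CachingStrategy K μ} {P : Fin K → PMF (Fin (B + 1))}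
  {d : Fin K → Fin N}

/-- The code with a given encoder in which each user takes some library that agrees with its channel
outputs and its cache, and outputs the requested file of this library. -/
def Code.ofEncoder (C : CachingStrategy K μ) (d : Fin K → Fin N)
    (enc : Library N F → Fin n → Fin B → ZMod 2) : Code C N B n F where
  encode := enc
  decode k L Y Z := Function.invFun
    (fun W => ((fun s => received (L s) (enc W s)), cacheContent C k W)) (Y, Z) (d k)

lemma Code.estimate_ofEncoder {enc : Library N F → Fin n → Fin B → ZMod 2} {k : Fin K}
    {W : Library N F} {L : Fin n → Fin (B + 1)}
    (hdet : ∀ W', (∀ s, received (L s) (enc W' s) = received (L s) (enc W s)) →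
      cacheContent C k W' = cacheContent C k W → W' (d k) = W (d k)) :
    (Code.ofEncoder C d enc).estimate k W L = W (d k) := by
  have h := Function.invFun_eq (f := fun W' : Library N F =>
    ((fun s => received (L s) (enc W' s)), cacheContent C k W')) ⟨W, rfl⟩
  exact hdet _ (congrFun (congrArg Prod.fst h)) (congrArg Prod.snd h)

lemma exists_errorProb_le {𝓔 : Type*} [Fintype 𝓔] [Nonempty 𝓔] {c : 𝓔 → Code C N B n F}
    {b : Fin K → ℝ} (h : ∀ k W, ∑ E, (Measure.pi fun _ : Fin n => (P k).toMeasure).real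
      {L | (c E).estimate k W L ≠ W (d k)} ≤ Nat.card 𝓔 * b k) :
    ∃ E, (c E).errorProb P d ≤ ∑ k, b k := by
  have havg : ∑ E, (c E).errorProb P d ≤ ∑ _E : 𝓔, ∑ k, b k := by
    simp only [Nat.card_eq_fintype_card] at h
    simp only [Code.errorProb]
    rw [Finset.sum_comm, Finset.sum_const, Finset.card_univ, nsmul_eq_mul, Finset.mul_sum]
    refine Finset.sum_le_sum fun k _ => ?_
    rw [← Finset.sum_div, div_le_iff₀ (by exact_mod_cast Fintype.card_pos), Finset.sum_comm]
    refine (Finset.sum_le_sum fun W _ => h k W).trans_eq ?_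
    rw [Finset.sum_const, Finset.card_univ, nsmul_eq_mul, mul_comm]
  obtain ⟨E, -, hE⟩ := Finset.exists_le_of_sum_le Finset.univ_nonempty havg
  exact ⟨E, hE⟩

variable {𝒮 α : Type*}

/-- The encoder that sends, as bit `ℓ` of channel use `s`, the symbol with number `(s, ℓ)` of the
codeword of the message `σ s ℓ`. All the messages share the codebook `E`, since different messages
use different symbols. -/
def codebookEncoder (σ : Fin n → Fin B → 𝒮) (M : 𝒮 → Library N F → α)
    (E : α → Fin n × Fin B → ZMod 2) (W : Library N F) : Fin n → Fin B → ZMod 2 :=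
  fun s ℓ => E (M (σ s ℓ) W) (s, ℓ)

variable [DecidableEq 𝒮]

/-- The delivered bits that carry the message `S` when bit `ℓ` of channel use `s` is assigned to the
message `σ s ℓ` and the channel states are `L`. -/
def delivered (σ : Fin n → Fin B → 𝒮) (S : 𝒮) (L : Fin n → Fin (B + 1)) :
    Finset (Fin n × Fin B) :=
  {i | (i.2 : ℕ) + 1 ≤ L i.1 ∧ σ i.1 i.2 = S}

lemma eqOn_delivered_of_received_eq {σ : Fin n → Fin B → 𝒮} {M : 𝒮 → Library N F → α}
    {E : α → Fin n × Fin B → ZMod 2} {L : Fin n → Fin (B + 1)} {W W' : Library N F}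
    (h : ∀ s, received (L s) (codebookEncoder σ M E W' s) =
      received (L s) (codebookEncoder σ M E W s)) (S : 𝒮) :
    ∀ i ∈ delivered σ S L, E (M S W') i = E (M S W) i := by
  rintro ⟨s, ℓ⟩ hi
  obtain ⟨hℓ, rfl⟩ := (Finset.mem_filter_univ _).1 hi
  simpa [received, codebookEncoder, hℓ] using congrFun (h s) ℓ

variable {Q : Fin K → Finset 𝒮} {M : 𝒮 → Library N F → α}

lemma exists_confusable_of_estimate_ne
    (hdec : ∀ k W W', cacheContent C k W = cacheContent C k W' →
      (∀ S ∈ Q k, M S W = M S W') → W (d k) = W' (d k))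
    {σ : Fin n → Fin B → 𝒮} {E : α → Fin n × Fin B → ZMod 2} {k : Fin K} {W : Library N F}
    {L : Fin n → Fin (B + 1)}
    (hne : (Code.ofEncoder C d (codebookEncoder σ M E)).estimate k W L ≠ W (d k)) :
    ∃ S ∈ Q k, Confusable E (M S W) (delivered σ S L) := by
  contrapose! hne
  refine Code.estimate_ofEncoder fun W' hrec hcache => hdec k W' W hcache fun S hS => ?_
  by_contra hM
  exact hne S hS ⟨M S W', hM, eqOn_delivered_of_received_eq hrec S⟩

lemma exists_code_of_determined [Fintype α] (hα : Fintype.card α ≤ 2 ^ m)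
    (hdec : ∀ k W W', cacheContent C k W = cacheContent C k W' →
      (∀ S ∈ Q k, M S W = M S W') → W (d k) = W' (d k))
    (P : Fin K → PMF (Fin (B + 1))) (σ : Fin n → Fin B → 𝒮) (h : ℕ) :
    ∃ c : Code C N B n F, c.errorProb P d ≤
      ∑ k, ∑ S ∈ Q k, ((Measure.pi fun _ : Fin n => (P k).toMeasure).real
        {L | #(delivered σ S L) < m + h} + (1 / 2) ^ h) := by
  classical
  suffices hk : ∀ k W, ∑ E, (Measure.pi fun _ : Fin n => (P k).toMeasure).real
      {L | (Code.ofEncoder C d (codebookEncoder σ M E)).estimate k W L ≠ W (d k)} ≤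
      Nat.card (α → Fin n × Fin B → ZMod 2) *
        ∑ S ∈ Q k, ((Measure.pi fun _ : Fin n => (P k).toMeasure).real
          {L | #(delivered σ S L) < m + h} + (1 / 2) ^ h) by
    obtain ⟨E, hE⟩ := exists_errorProb_le hk
    exact ⟨_, hE⟩
  intro k W
  set ν := Measure.pi fun _ : Fin n => (P k).toMeasure
  calc ∑ E, ν.real {L | (Code.ofEncoder C d (codebookEncoder σ M E)).estimate k W L ≠ W (d k)}
      ≤ ∑ E, ∑ S ∈ Q k, ν.real {L | Confusable E (M S W) (delivered σ S L)} :=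
        Finset.sum_le_sum fun E _ => (measureReal_mono (fun L hL => by
          simpa using exists_confusable_of_estimate_ne hdec hL) (measure_ne_top _ _)).trans
            (measureReal_biUnion_finset_le _ _)
    _ = ∑ S ∈ Q k, ∑ E, ν.real {L | Confusable E (M S W) (delivered σ S L)} := Finset.sum_comm
    _ ≤ ∑ S ∈ Q k, Nat.card (α → Fin n × Fin B → ZMod 2) *
          (ν.real {L | #(delivered σ S L) < m + h} + (1 / 2) ^ h) :=
        Finset.sum_le_sum fun S _ => sum_measureReal_le_card_mul
          (fun _ => (Set.toFinite _).measurableSet) (Set.toFinite _).measurableSet (by positivity)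
          fun L hL => natCard_confusable_le hα _ (not_lt.1 hL)
    _ = _ := (Finset.mul_sum _ _ _).symm

end RandomCoding

section Concentration

lemma measureReal_pi_sum_lt_le {ι : Type*} [Fintype ι] {Ω : ι → Type*}
    [∀ i, MeasurableSpace (Ω i)] (μ : ∀ i, Measure (Ω i)) [∀ i, IsProbabilityMeasure (μ i)]
    {X : ∀ i, Ω i → ℝ} (hX : ∀ i, Measurable (X i)) {a b : ℝ}
    (hab : ∀ i x, X i x ∈ Set.Icc a b) {m δ : ℝ} (hδ : 0 < δ)
    (hm : m + δ ≤ ∑ i, ∫ x, X i x ∂μ i) :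
    (Measure.pi μ).real {x | ∑ i, X i (x i) < m} ≤
      Fintype.card ι * ((b - a) / 2) ^ 2 / δ ^ 2 := by
  have hLp (i : ι) : MemLp (X i) 2 (μ i) :=
    memLp_of_bounded (ae_of_all _ (hab i)) (hX i).aestronglyMeasurable 2
  have hLp' (i : ι) : MemLp (fun x : ∀ i, Ω i => X i (x i)) 2 (Measure.pi μ) :=
    (hLp i).comp_measurePreserving (measurePreserving_eval μ i)
  set Y : (∀ i, Ω i) → ℝ := ∑ i, fun x => X i (x i) with hY
  have hmean : ∫ x, Y x ∂Measure.pi μ = ∑ i, ∫ x, X i x ∂μ i := by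
    simp only [hY, Finset.sum_apply]
    rw [integral_finsetSum _ fun i _ => (hLp' i).integrable one_le_two]
    exact Finset.sum_congr rfl fun i _ => integral_comp_eval (hX i).aestronglyMeasurable
  have hvar : ProbabilityTheory.variance Y (Measure.pi μ) ≤
      Fintype.card ι * ((b - a) / 2) ^ 2 := by
    rw [hY, ProbabilityTheory.variance_sum_pi hLp, ← nsmul_eq_mul]
    exact Finset.sum_le_card_nsmul _ _ _ fun i _ =>
      ProbabilityTheory.variance_le_sq_of_bounded (ae_of_all _ (hab i)) (hX i).aemeasurable
  calc (Measure.pi μ).real {x | ∑ i, X i (x i) < m}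
      ≤ (Measure.pi μ).real {x | δ ≤ |Y x - ∫ x, Y x ∂Measure.pi μ|} := by
        refine measureReal_mono (fun x (hx : ∑ i, X i (x i) < m) => ?_)
        rw [Set.mem_ofPred_eq, hmean, hY, Finset.sum_apply, abs_sub_comm]
        exact (by linarith : δ ≤ _).trans (le_abs_self _)
    _ ≤ ProbabilityTheory.variance Y (Measure.pi μ) / δ ^ 2 :=
        ENNReal.toReal_le_of_le_ofReal
          (div_nonneg (ProbabilityTheory.variance_nonneg _ _) (sq_nonneg _))
          (ProbabilityTheory.meas_ge_le_variance_div_sq (memLp_finsetSum' _ fun i _ => hLp' i) hδ)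
    _ ≤ Fintype.card ι * ((b - a) / 2) ^ 2 / δ ^ 2 := by gcongr

variable {B n : ℕ} {p : PMF (Fin (B + 1))} {ℓ : Fin B}

lemma ccdf_nonneg : 0 ≤ ccdf p ℓ := measureReal_nonneg

lemma ccdf_le_one : ccdf p ℓ ≤ 1 := measureReal_le_one

lemma integral_card_filter_eq_sum_ccdf (q : Fin B → Prop) [DecidablePred q] :
    ∫ x, (#{ℓ : Fin B | (ℓ : ℕ) + 1 ≤ x ∧ q ℓ} : ℝ) ∂p.toMeasure = ∑ ℓ with q ℓ, ccdf p ℓ := by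
  have hind (x : Fin (B + 1)) : (#{ℓ : Fin B | (ℓ : ℕ) + 1 ≤ x ∧ q ℓ} : ℝ) =
      ∑ ℓ with q ℓ, Set.indicator {x : Fin (B + 1) | (ℓ : ℕ) + 1 ≤ (x : ℕ)} 1 x := by
    simp [Set.indicator_apply, Finset.filter_filter, and_comm]
  simp only [hind]
  rw [integral_finsetSum _ fun _ _ => Integrable.of_finite]
  exact Finset.sum_congr rfl fun ℓ _ => integral_indicator_one (Set.toFinite _).measurableSet

variable {𝒮 : Type*} [DecidableEq 𝒮] {σ : Fin n → Fin B → 𝒮} {S : 𝒮}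

lemma card_delivered (L : Fin n → Fin (B + 1)) :
    #(delivered σ S L) = ∑ s, #{ℓ : Fin B | (ℓ : ℕ) + 1 ≤ L s ∧ σ s ℓ = S} := by
  simp only [delivered, Finset.card_filter, ← Finset.univ_product_univ, Finset.sum_product]

lemma measureReal_card_delivered_lt_le {a : Fin B → ℕ}
    (ha : ∀ ℓ, a ℓ ≤ Nat.card {s // σ s ℓ = S}) {m : ℕ} {δ : ℝ} (hδ : 0 < δ)
    (hm : m + δ ≤ ∑ ℓ, ccdf p ℓ * a ℓ) :
    (Measure.pi fun _ : Fin n => p.toMeasure).real {L | #(delivered σ S L) < m} ≤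
      n * ((B : ℝ) / 2) ^ 2 / δ ^ 2 := by
  have hmean : ∑ ℓ, ccdf p ℓ * a ℓ ≤ ∑ s, ∑ ℓ with σ s ℓ = S, ccdf p ℓ := by
    simp only [Finset.sum_filter]
    rw [Finset.sum_comm]
    refine Finset.sum_le_sum fun ℓ _ => ?_
    rw [← Finset.sum_filter, Finset.sum_const, nsmul_eq_mul, mul_comm, ← Fintype.card_subtype,
      ← Nat.card_eq_fintype_card]
    exact mul_le_mul_of_nonneg_right (by exact_mod_cast ha ℓ) ccdf_nonneg
  simp only [← integral_card_filter_eq_sum_ccdf] at hmean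
  have hbound (s : Fin n) (x : Fin (B + 1)) :
      (#{ℓ : Fin B | (ℓ : ℕ) + 1 ≤ x ∧ σ s ℓ = S} : ℝ) ∈ Set.Icc (0 : ℝ) B :=
    ⟨Nat.cast_nonneg _, by exact_mod_cast (Finset.card_le_univ _).trans_eq (Fintype.card_fin B)⟩
  have hcheb := measureReal_pi_sum_lt_le (fun _ : Fin n => p.toMeasure)
    (fun s => measurable_of_finite _) hbound hδ (hm.trans hmean)
  simp only [← Nat.cast_sum, ← card_delivered, Nat.cast_lt] at hcheb
  simpa using hcheb

end Concentration

section LinearProgram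

lemma exists_le_natCard_fiber {ι 𝒮 : Type*} [Fintype ι] [Fintype 𝒮] [Nonempty 𝒮] {a : 𝒮 → ℕ}
    (ha : ∑ S, a S ≤ Fintype.card ι) : ∃ σ : ι → 𝒮, ∀ S, a S ≤ Nat.card {i // σ i = S} := by
  obtain ⟨e⟩ : Nonempty ((Σ S, Fin (a S)) ↪ ι) :=
    Function.Embedding.nonempty_of_card_le (by simpa using ha)
  set σ : ι → 𝒮 := Function.extend e Sigma.fst fun _ => Classical.arbitrary 𝒮
  have hσ (S : 𝒮) (j : Fin (a S)) : σ (e ⟨S, j⟩) = S := e.injective.extend_apply _ _ _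
  refine ⟨σ, fun S => ?_⟩
  simpa using Nat.card_le_card_of_injective (fun j => (⟨e ⟨S, j⟩, hσ S j⟩ : {i // σ i = S}))
    fun j j' h => by simpa using h

variable {K B t : ℕ} {P : Fin K → PMF (Fin (B + 1))}

namespace LPFeasible

variable {f : ℝ} {y : Fin B → UserSet K t → ℝ}

lemma allocation_le_one (h : LPFeasible P t f y) (ℓ : Fin B) (S : UserSet K t) : y ℓ S ≤ 1 :=
  (Finset.single_le_sum (fun S _ => h.nonneg ℓ S) (Finset.mem_univ S)).trans (h.level ℓ)

lemma rate_le (h : LPFeasible P t f y) (htK : t < K) : f ≤ B * K.choose t := by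
  have hchoose : (0 : ℝ) < K.choose t := by exact_mod_cast Nat.choose_pos htK.le
  obtain ⟨S, hS⟩ := exists_userSet_mem htK ⟨t, htK⟩
  rw [← div_le_iff₀ hchoose]
  calc f / K.choose t ≤ ∑ ℓ, ccdf (P ⟨t, htK⟩) ℓ * y ℓ S := h.decodable S _ hS
    _ ≤ ∑ _ℓ : Fin B, (1 : ℝ) := Finset.sum_le_sum fun ℓ _ =>
        mul_le_one₀ ccdf_le_one (h.nonneg ℓ S) (h.allocation_le_one ℓ S)
    _ = B := by simp

lemma zero : LPFeasible P t 0 0 where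
  rate_nonneg := le_rfl
  nonneg _ _ := le_rfl
  level _ := by simp
  decodable _ _ _ := by simp

lemma exists_slotAssignment (h : LPFeasible P t f y) (htK : t < K) (n : ℕ) :
    ∃ σ : Fin n → Fin B → UserSet K t, ∀ ℓ S, ⌊n * y ℓ S⌋₊ ≤ Nat.card {s // σ s ℓ = S} := by
  obtain ⟨S₀, -⟩ := exists_userSet_mem htK ⟨t, htK⟩
  have : Nonempty (UserSet K t) := ⟨S₀⟩
  have hfit (ℓ : Fin B) : ∑ S, ⌊n * y ℓ S⌋₊ ≤ Fintype.card (Fin n) := by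
    have : ∑ S, (⌊n * y ℓ S⌋₊ : ℝ) ≤ n :=
      calc ∑ S, (⌊n * y ℓ S⌋₊ : ℝ) ≤ ∑ S, n * y ℓ S :=
            Finset.sum_le_sum fun S _ =>
              Nat.floor_le (mul_nonneg (Nat.cast_nonneg _) (h.nonneg ℓ S))
        _ = n * ∑ S, y ℓ S := (Finset.mul_sum _ _ _).symm
        _ ≤ n := mul_le_of_le_one_right (Nat.cast_nonneg n) (h.level ℓ)
    rw [Fintype.card_fin]
    exact_mod_cast this
  choose σ hσ using fun ℓ => exists_le_natCard_fiber (hfit ℓ)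
  exact ⟨fun s ℓ => σ ℓ s, hσ⟩

lemma sub_le_sum_ccdf_mul_floor (h : LPFeasible P t f y) (n : ℕ) {S : UserSet K t} {k : Fin K}
    (hk : k ∈ S.1) :
    n * (f / K.choose t) - B ≤ ∑ ℓ, ccdf (P k) ℓ * (⌊n * y ℓ S⌋₊ : ℝ) :=
  calc n * (f / K.choose t) - B ≤ n * (∑ ℓ, ccdf (P k) ℓ * y ℓ S) - B := by
        gcongr
        exact h.decodable S k hk
    _ = ∑ ℓ, (ccdf (P k) ℓ * (n * y ℓ S) - 1) := by
        simp [Finset.mul_sum, mul_left_comm]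
    _ ≤ ∑ ℓ, ccdf (P k) ℓ * (⌊n * y ℓ S⌋₊ : ℝ) := Finset.sum_le_sum fun ℓ _ => by
        have hfloor := (Nat.sub_one_lt_floor (n * y ℓ S)).le
        have hscaled := mul_le_mul_of_nonneg_left hfloor (ccdf_nonneg (p := P k) (ℓ := ℓ))
        linarith [ccdf_le_one (p := P k) (ℓ := ℓ)]

end LPFeasible

lemma isClosed_setOf_lpFeasible :
    IsClosed {q : ℝ × (Fin B → UserSet K t → ℝ) | LPFeasible P t q.1 q.2} := by
  have hinter : {q : ℝ × (Fin B → UserSet K t → ℝ) | LPFeasible P t q.1 q.2} =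
      {q | 0 ≤ q.1} ∩ (⋂ ℓ, ⋂ S, {q | 0 ≤ q.2 ℓ S}) ∩ (⋂ ℓ, {q | ∑ S, q.2 ℓ S ≤ 1}) ∩
        ⋂ S : UserSet K t, ⋂ k ∈ S.1,
          {q | q.1 / (K.choose t : ℝ) ≤ ∑ ℓ, ccdf (P k) ℓ * q.2 ℓ S} := by
    ext q
    simp only [Set.mem_ofPred_eq, Set.mem_inter_iff, Set.mem_iInter]
    exact ⟨fun h => ⟨⟨⟨h.1, h.2⟩, h.3⟩, h.4⟩, fun h => ⟨h.1.1.1, h.1.1.2, h.1.2, h.2⟩⟩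
  rw [hinter]
  refine (((isClosed_le ?_ ?_).inter (isClosed_iInter fun ℓ => isClosed_iInter fun S =>
    isClosed_le ?_ ?_)).inter (isClosed_iInter fun ℓ => isClosed_le ?_ ?_)).inter
      (isClosed_iInter fun S => isClosed_iInter fun k => isClosed_iInter fun _ =>
        isClosed_le ?_ ?_) <;> fun_prop

lemma isCompact_lpRates (htK : t < K) : IsCompact (lpRates P t) := by
  have hbox : {q : ℝ × (Fin B → UserSet K t → ℝ) | LPFeasible P t q.1 q.2} ⊆
      Set.Icc 0 ((B * K.choose t : ℝ), fun _ _ => 1) := fun q hq =>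
    ⟨⟨hq.rate_nonneg, hq.nonneg⟩, ⟨hq.rate_le htK, hq.allocation_le_one⟩⟩
  have himage : lpRates P t =
      Prod.fst '' {q : ℝ × (Fin B → UserSet K t → ℝ) | LPFeasible P t q.1 q.2} := by
    ext f
    simp [lpRates]
  rw [himage]
  exact (isCompact_Icc.of_isClosed_subset isClosed_setOf_lpFeasible hbox).image continuous_fst

lemma isGreatest_fLP (htK : t < K) : IsGreatest (lpRates P t) (fLP P t) :=
  (isCompact_lpRates htK).isGreatest_sSup ⟨0, 0, LPFeasible.zero⟩

end LinearProgram

section Achievability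

variable {K N B t : ℕ} {μ : ℝ} {C : CachingStrategy K μ} {P : Fin K → PMF (Fin (B + 1))}
  {d : Fin K → Fin N}

lemma LPFeasible.exists_code {f : ℝ} {y : Fin B → UserSet K t → ℝ} (hy : LPFeasible P t f y)
    (hC : C.IsCentralized t) (htK : t < K) (d : Fin K → Fin N) {n F : ℕ} {δ : ℝ} (hδ : 0 < δ)
    (hF : (F : ℝ) / K.choose t + (K + 1) * #C.endpoints + B + 2 * δ ≤ n * (f / K.choose t)) :
    ∃ c : Code C N B n F, c.errorProb P d ≤
      K * (K.choose (t + 1) * (n * ((B : ℝ) / 2) ^ 2 / δ ^ 2 + (1 / 2) ^ ⌊δ⌋₊)) := by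
  set g := ⌊(F : ℝ) / K.choose t + #C.endpoints⌋₊
  have hg (T : Finset (Fin K)) (hT : #T = t) : #{i : Fin F | C.cachers i = T} ≤ g :=
    Nat.le_floor (hC.card_filter_cachers_eq_le F hT)
  obtain ⟨σ, hσ⟩ := hy.exists_slotAssignment htK n
  obtain ⟨c, hc⟩ := exists_code_of_determined (d := d) (M := fun S : UserSet K t =>
    C.codedMessage d t g S.1) (Q := fun k => {S : UserSet K t | k ∈ S.1})
    (hC.card_messageSpace_le htK F g)
    (fun k W W' hcache hmsg => CachingStrategy.apply_eq_of_codedMessage_eq htK hg hcache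
      fun S hk => hmsg S ((Finset.mem_filter_univ S).2 hk)) P σ ⌊δ⌋₊
  have hload (k : Fin K) (S : UserSet K t) (hk : k ∈ S.1) :
      ((g + K * #C.endpoints + ⌊δ⌋₊ : ℕ) : ℝ) + δ ≤ ∑ ℓ, ccdf (P k) ℓ * (⌊n * y ℓ S⌋₊ : ℝ) := by
    have hg_le : (g : ℝ) ≤ F / K.choose t + #C.endpoints := Nat.floor_le (by positivity)
    have hδ_le : (⌊δ⌋₊ : ℝ) ≤ δ := Nat.floor_le hδ.le
    push_cast
    linarith [hy.sub_le_sum_ccdf_mul_floor n hk]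
  have herror (k : Fin K) (S : UserSet K t) (hk : k ∈ S.1) :=
    measureReal_card_delivered_lt_le (hσ · S) hδ (hload k S hk)
  refine ⟨c, hc.trans ?_⟩
  calc _ ≤ ∑ k : Fin K, ∑ S : UserSet K t with k ∈ S.1,
          (n * ((B : ℝ) / 2) ^ 2 / δ ^ 2 + (1 / 2) ^ ⌊δ⌋₊) :=
        Finset.sum_le_sum fun k _ => Finset.sum_le_sum fun S hS =>
          add_le_add_left (herror k S ((Finset.mem_filter_univ S).1 hS)) _
    _ ≤ ∑ _k : Fin K, ∑ _S : UserSet K t,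
          (n * ((B : ℝ) / 2) ^ 2 / δ ^ 2 + (1 / 2) ^ ⌊δ⌋₊) :=
        Finset.sum_le_sum fun k _ => Finset.sum_le_univ_sum_of_nonneg fun _ => by positivity
    _ = _ := by
        simp only [Finset.sum_const, Finset.card_univ, Fintype.card_fin, Fintype.card_finset_len,
          nsmul_eq_mul]

lemma Code.errorProb_nonneg {n F : ℕ} (c : Code C N B n F) : 0 ≤ c.errorProb P d :=
  Finset.sum_nonneg fun _ _ =>
    div_nonneg (Finset.sum_nonneg fun _ _ => measureReal_nonneg) (Nat.cast_nonneg _)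

instance (n F : ℕ) : Nonempty (Code C N B n F) := ⟨⟨0, 0⟩⟩

lemma reliablyServed_of_eventually {F : ℕ → ℕ} {b : ℕ → ℝ} (hb : Tendsto b atTop (𝓝 0))
    (h : ∀ᶠ n in atTop, ∃ c : Code C N B n (F n), c.errorProb P d ≤ b n) :
    ReliablyServed C P d F :=
  ⟨fun n => Classical.epsilon fun c => c.errorProb P d ≤ b n,
    squeeze_zero' (Eventually.of_forall fun _ => Code.errorProb_nonneg _)
      (h.mono fun _ hn => Classical.epsilon_spec hn) hb⟩

lemma reliablyServed_zero (C : CachingStrategy K μ) (P : Fin K → PMF (Fin (B + 1)))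
    (d : Fin K → Fin N) : ReliablyServed C P d fun _ => 0 := by
  refine reliablyServed_of_eventually tendsto_const_nhds (.of_forall fun n => ⟨⟨0, 0⟩, ?_⟩)
  have hcorrect (k : Fin K) (W : Library N 0) (L : Fin n → Fin (B + 1)) :
      (⟨0, 0⟩ : Code C N B n 0).estimate k W L = W (d k) := Subsingleton.elim _ _
  simp [Code.errorProb, hcorrect]

section Backoff

variable {δ : ℕ → ℝ}

lemma tendsto_atTop_of_div_sqrt (hδ : Tendsto (fun n => δ n / √n) atTop atTop) :
    Tendsto δ atTop atTop := by
  refine (hδ.atTop_mul_atTop₀ (Real.tendsto_sqrt_atTop.comp tendsto_natCast_atTop_atTop)).congr' ?_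
  filter_upwards [eventually_gt_atTop 0] with n hn
  exact div_mul_cancel₀ _ (Real.sqrt_pos.2 (Nat.cast_pos.2 hn)).ne'

lemma tendsto_natCast_mul_div_sq (hδ : Tendsto (fun n => δ n / √n) atTop atTop) (v : ℝ) :
    Tendsto (fun n => n * v / δ n ^ 2) atTop (𝓝 0) := by
  refine (tendsto_const_nhds (x := v) |>.div_atTop
    ((tendsto_pow_atTop two_ne_zero).comp hδ)).congr fun n => ?_
  simp only [Function.comp_apply, div_pow, Real.sq_sqrt (Nat.cast_nonneg n), div_div_eq_mul_div,
    mul_comm]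

end Backoff

/-- The number of delivered bits of a message fluctuates by the order of `√n`, hence a backoff of
larger order makes decoding reliable. -/
lemma reliablyServed_of_tendsto_atTop (hC : C.IsCentralized t) (htK : t < K) (d : Fin K → Fin N)
    {f : ℝ} (hf : f ∈ lpRates P t) {F : ℕ → ℕ}
    (hF : Tendsto (fun n => (n * f - F n) / √n) atTop atTop) : ReliablyServed C P d F := by
  obtain ⟨y, hy⟩ := hf
  have hchoose : (0 : ℝ) < K.choose t := by exact_mod_cast Nat.choose_pos htK.le
  set δ : ℕ → ℝ := fun n => (n * f - F n) / (4 * K.choose t) with hδ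
  have hδ_sqrt : Tendsto (fun n => δ n / √n) atTop atTop :=
    (hF.atTop_div_const (by positivity : 0 < 4 * (K.choose t : ℝ))).congr fun n =>
      div_right_comm _ _ _
  have hδ_atTop : Tendsto δ atTop atTop := tendsto_atTop_of_div_sqrt hδ_sqrt
  have hcode : Tendsto (fun n => ((1 : ℝ) / 2) ^ ⌊δ n⌋₊) atTop (𝓝 0) :=
    (tendsto_pow_atTop_nhds_zero_of_lt_one (by norm_num) (by norm_num)).comp
      (tendsto_nat_floor_atTop.comp hδ_atTop)
  have hbound : Tendsto (fun n => K * (K.choose (t + 1) *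
      (n * ((B : ℝ) / 2) ^ 2 / δ n ^ 2 + (1 / 2) ^ ⌊δ n⌋₊))) atTop (𝓝 0) := by
    simpa using (((tendsto_natCast_mul_div_sq hδ_sqrt _).add hcode).const_mul
      (K.choose (t + 1) : ℝ)).const_mul (K : ℝ)
  refine reliablyServed_of_eventually hbound ?_
  filter_upwards [hδ_atTop.eventually_gt_atTop 0,
    hδ_atTop.eventually_ge_atTop (((K + 1) * #C.endpoints + B) / 2)] with n hpos hlarge
  have hgap : n * (f / K.choose t) - F n / K.choose t = 4 * δ n := by
    simp only [hδ]
    field_simp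
  exact hy.exists_code hC htK d hpos (by linarith)

lemma reliablyServed_natFloor (hC : C.IsCentralized t) (htK : t < K) (d : Fin K → Fin N)
    {f f' : ℝ} (hf : 0 ≤ f) (hff' : f < f') (hf' : f' ∈ lpRates P t) :
    ReliablyServed C P d fun n => ⌊n * f⌋₊ := by
  refine reliablyServed_of_tendsto_atTop hC htK d hf' ?_
  refine tendsto_atTop_mono (fun n => ?_) ((Real.tendsto_sqrt_atTop.comp
    tendsto_natCast_atTop_atTop).atTop_mul_const (sub_pos.2 hff'))
  calc √n * (f' - f) = (n * f' - n * f) / √n := by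
        rw [← mul_sub, mul_div_right_comm, Real.div_sqrt]
    _ ≤ (n * f' - ⌊n * f⌋₊) / √n := by
        gcongr
        exact Nat.floor_le (by positivity)

lemma isAchievable_of_mem_lpRates (hC : C.IsCentralized t) (htK : t < K) (d : Fin K → Fin N)
    {f : ℝ} (hf : f ∈ lpRates P t) : IsAchievable C P d f := by
  obtain ⟨y, hy⟩ := id hf
  rcases hy.rate_nonneg.eq_or_lt with rfl | hpos
  · exact ⟨fun _ => 0, by simp, reliablyServed_zero C P d⟩
  -- The backoff `n ^ (3 / 4)` is of larger order than `√n`, but does not affect the rate.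
  set x : ℕ → ℝ := fun n => n * (f - (n : ℝ) ^ (-(1 / 4) : ℝ)) with hx
  have hrate : Tendsto (fun n : ℕ => f - (n : ℝ) ^ (-(1 / 4) : ℝ)) atTop (𝓝 f) := by
    simpa using tendsto_const_nhds.sub
      ((tendsto_rpow_neg_atTop (by norm_num : (0 : ℝ) < 1 / 4)).comp tendsto_natCast_atTop_atTop)
  have hx_atTop : Tendsto x atTop atTop := tendsto_natCast_atTop_atTop.atTop_mul_pos hpos hrate
  refine ⟨fun n => ⌊x n⌋₊, ?_, reliablyServed_of_tendsto_atTop hC htK d hf ?_⟩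
  · have hfloor := ((tendsto_nat_floor_div_atTop (R := ℝ)).comp hx_atTop).mul hrate
    rw [one_mul] at hfloor
    refine hfloor.congr' ?_
    filter_upwards [eventually_gt_atTop 0, hx_atTop.eventually_gt_atTop 0] with n hn hxn
    have hn' : (n : ℝ) ≠ 0 := by exact_mod_cast hn.ne'
    have hfactor : f - (n : ℝ) ^ (-(1 / 4) : ℝ) = x n / n := by rw [hx, mul_div_cancel_left₀ _ hn']
    rw [Function.comp_apply, hfactor, div_mul_div_cancel₀ hxn.ne']
  · refine tendsto_atTop_mono' _ ?_ ((tendsto_rpow_atTop (by norm_num : (0 : ℝ) < 1 / 4)).comp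
      tendsto_natCast_atTop_atTop)
    filter_upwards [eventually_gt_atTop 0, hx_atTop.eventually_ge_atTop 0] with n hn hxn
    have hn' : (0 : ℝ) < n := by exact_mod_cast hn
    calc (n : ℝ) ^ (1 / 4 : ℝ) = √n * (n : ℝ) ^ (-(1 / 4) : ℝ) := by
          rw [Real.sqrt_eq_rpow, ← Real.rpow_add hn']
          norm_num
      _ = (n * f - x n) / √n := by
          rw [hx, ← mul_sub, sub_sub_cancel, mul_div_right_comm, Real.div_sqrt]
      _ ≤ (n * f - ⌊x n⌋₊) / √n := by
          gcongr
          exact Nat.floor_le hxn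

end Achievability

end

end CodedCaching

theorem proposition2_general {K N B t : ℕ} {μ : ℝ} (htK : t < K)
    (P : Fin K → PMF (Fin (B + 1)))
    (C : CodedCaching.CachingStrategy K μ) (hC : C.IsCentralized t) (d : Fin K → Fin N) :
    IsGreatest (CodedCaching.lpRates P t) (CodedCaching.fLP P t) ∧
    CodedCaching.IsAchievable C P d (CodedCaching.fLP P t) ∧
    ∀ f : ℝ, 0 ≤ f → f < CodedCaching.fLP P t →
      CodedCaching.ReliablyServed C P d (fun n => ⌊(n : ℝ) * f⌋₊) := by
  have hmax := CodedCaching.isGreatest_fLP (P := P) htK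
  exact ⟨hmax, CodedCaching.isAchievable_of_mem_lpRates hC htK d hmax.1,
    fun _ hf hlt => CodedCaching.reliablyServed_natFloor hC htK d hf hlt hmax.1⟩

theorem proposition2 {K N B t : ℕ} {μ : ℝ}
    (ht : (K : ℝ) * μ = t) (htK : t < K)
    (P : Fin K → PMF (Fin (B + 1)))
    (C : CodedCaching.CachingStrategy K μ) (hC : C.IsCentralized t)
    (d : Fin K → Fin N) (hd : Function.Injective d) :
    IsGreatest (CodedCaching.lpRates P t) (CodedCaching.fLP P t) ∧
    CodedCaching.IsAchievable C P d (CodedCaching.fLP P t) ∧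
    ∀ f : ℝ, 0 ≤ f → f < CodedCaching.fLP P t →
      CodedCaching.ReliablyServed C P d (fun n => ⌊(n : ℝ) * f⌋₊) :=
  proposition2_general htK P C hC d
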